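/- Let \(X\) be a locally compact Hausdorff, path connected, locally path connected and semilocally simply connected topological space, and let \(x_0\in X\). (Semilocally simply connected: every \(x\in X\) has a neighbourhood \(U\) such that every loop at \(x\) in \(U\) is null-homotopic in \(X\) relative to the end points.) A Radon measure is a positive regular Borel measure that is finite on compact sets (equivalently, a positive linear functional on \(C_c\)); it is fully supported if every nonempty open set has positive measure. Let \(G=\Pi_1(X)\) be the fundamental groupoid: the set of paths \(\gamma\colon[0,1]\to X\) modulo homotopy relative to the end points, with the quotient topology of the compact-open topology, source \(s([\gamma])=\gamma(0)\), range \(r([\gamma])=\gamma(1)\), and product \([\gamma][\eta]\) (for \(\eta(1)=\gamma(0)\)) the class of \(\eta\) followed by \(\gamma\). Put \(G^u=r^{-1}(u)\) for \(u\in X\). A Haar system on \(G\) is a family \(\{\alpha^u\}_{u\in X}\) of Radon measures on \(G\) such that \(\alpha^u\) is concentrated on \(G^u\) and has support \(G^u\); for every \(f\in C_c(G)\) the function \(u\mapsto\int f\,d\alpha^u\) is in \(C_c(X)\); and \[ \int_{G^{s(\gamma)}} f(\gamma\eta)\,d\alpha^{s(\gamma)}(\eta)=\int_{G^{r(\gamma)}}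 f(\eta)\,d\alpha^{r(\gamma)}(\eta)\qquad(\gamma\in G,\ f\in C_c(G)). \] Let \(\tilde X=G^{x_0}\), with the subspace topology, be the space of homotopy classes of paths ending at \(x_0\), let \(p=s|_{\tilde X}\colon\tilde X\to X\), and let \(\pi_1(X)=\pi_1(X,x_0)=\{g\in G: s(g)=r(g)=x_0\}\) act on \(\tilde X\) by left multiplication in \(G\). Then \(p\) is a covering map and \(\tilde X\) is simply connected, so that \(\tilde X\) is the universal covering space of \(X\). Consider the following statements: 1. the fundamental groupoid \(\Pi_1(X)\) has a Haar system; 2. the universal covering space \(\tilde X\) has a \(\pi_1(X)\)-invariant fully supported Radon measure; 3. \(X\) has a fully supported Radon measure. Then (1) \(\iff\) (2) and (3) \(\implies\) (2). If \(X\) is paracompact, then (2) \(\implies\) (3). -/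

import Mathlib

open MeasureTheory Topology

universe u

/-- Every point `x` has a neighbourhood `U` such that each loop at `x` inside `U` is homotopic
in `X`, relative to the end points, to the constant loop. -/
def SemilocallySimplyConnected (X : Type u) [TopologicalSpace X] : Prop :=
  ∀ x : X, ∃ U ∈ 𝓝 x, ∀ γ : Path x x, Set.range γ ⊆ U → γ.Homotopic (Path.refl x)

/-- The space of arrows of the fundamental groupoid `Π₁(X)`: a class, under homotopy relative to
the end points, of paths from the source `src` to the range `tgt`. -/
@[ext]
structure Pi1 (X : Type u) [TopologicalSpace X] where
  src : X
  tgt : X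
  cls : Path.Homotopic.Quotient src tgt

namespace Pi1

variable {X : Type u} [TopologicalSpace X]

/-- The arrow represented by a path `f : [0, 1] → X`. -/
def ofPath (f : C(unitInterval, X)) : Pi1 X :=
  ⟨f 0, f 1, Path.Homotopic.Quotient.mk ⟨f, rfl, rfl⟩⟩

/-- The quotient topology of the compact-open topology on the space of all paths. -/
instance : TopologicalSpace (Pi1 X) :=
  TopologicalSpace.coinduced (ofPath (X := X)) inferInstance

instance : MeasurableSpace (Pi1 X) := borel _

instance : BorelSpace (Pi1 X) := ⟨rfl⟩

/-- The product `γ η` of composable arrows: run through `η` first and through `γ` afterwards. -/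
noncomputable def mul (γ η : Pi1 X) (h : η.tgt = γ.src) : Pi1 X :=
  ⟨η.src, γ.tgt, η.cls.trans (γ.cls.cast h rfl)⟩

theorem one_mul {x : X} (γ : Pi1 X) (h : γ.tgt = x) :
    mul ⟨x, x, Path.Homotopic.Quotient.refl x⟩ γ h = γ := by
  obtain ⟨y, z, c⟩ := γ
  subst h
  simp only [mul, Path.Homotopic.Quotient.cast_rfl_rfl]
  exact congrArg (Pi1.mk y z) (Path.Homotopic.Quotient.trans_refl c)

theorem mul_assoc (γ δ η : Pi1 X) (h : δ.tgt = γ.src) (h' : η.tgt = δ.src) :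
    (γ.mul δ h).mul η h' = γ.mul (δ.mul η h') h := by
  obtain ⟨x, w, a⟩ := γ
  obtain ⟨y, x', b⟩ := δ
  obtain ⟨z, y', c⟩ := η
  dsimp only at h h'
  subst h h'
  simp only [mul, Path.Homotopic.Quotient.cast_rfl_rfl]
  exact congrArg (Pi1.mk z w) (Path.Homotopic.Quotient.trans_assoc c b a).symm

/-- The product of loops in `Π₁(X)` is the product in the fundamental group. -/
theorem mul_loop {x : X} (g k : FundamentalGroup X x) :
    mul ⟨x, x, g⟩ ⟨x, x, k⟩ rfl = ⟨x, x, g * k⟩ := by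
  simp only [mul, Path.Homotopic.Quotient.cast_rfl_rfl]
  rfl

/-- The fibre `G^u` of the range map. -/
def rangeFibre (u : X) : Set (Pi1 X) := {γ | γ.tgt = u}

open Classical in
/-- The function `η ↦ f (γ η)` on the fibre `G^{s(γ)}`, extended by zero. -/
noncomputable def translate (γ : Pi1 X) (f : Pi1 X → ℂ) (η : Pi1 X) : ℂ :=
  if h : η.tgt = γ.src then f (γ.mul η h) else 0

end Pi1

/-- A Haar system on `G = Π₁(X)`: a family `α^u` (`u ∈ X`) of Radon measures on `G`, where `α^u`
is concentrated on `G^u` and has support `G^u`, that is continuous (it maps `C_c(G)` to `C_c(X)`)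
and invariant under left multiplication. -/
structure IsHaarSystem {X : Type u} [TopologicalSpace X] (α : X → Measure (Pi1 X)) : Prop where
  regular : ∀ u, (α u).Regular
  concentrated : ∀ u, α u (Pi1.rangeFibre u)ᶜ = 0
  support_eq : ∀ u, (α u).support = Pi1.rangeFibre u
  continuous : ∀ f : Pi1 X → ℂ, Continuous f → HasCompactSupport f →
    Continuous (fun u => ∫ η, f η ∂(α u)) ∧ HasCompactSupport (fun u => ∫ η, f η ∂(α u))
  invariant : ∀ (γ : Pi1 X) (f : Pi1 X → ℂ), Continuous f → HasCompactSupport f →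
    ∫ η, γ.translate f η ∂(α γ.src) = ∫ η, f η ∂(α γ.tgt)

/-- The universal covering space of `X` based at `x₀`: the space of homotopy classes of paths in
`X` that end at `x₀`, a subspace of `Π₁(X)`. -/
def UniversalCover (X : Type u) [TopologicalSpace X] (x₀ : X) : Type u :=
  {γ : Pi1 X // γ.tgt = x₀}

namespace UniversalCover

variable {X : Type u} [TopologicalSpace X] {x₀ : X}

instance : TopologicalSpace (UniversalCover X x₀) :=
  inferInstanceAs (TopologicalSpace {γ : Pi1 X // γ.tgt = x₀})

instance : MeasurableSpace (UniversalCover X x₀) := borel _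

instance : BorelSpace (UniversalCover X x₀) := ⟨rfl⟩

/-- The covering projection, which takes a class of paths to the starting point. -/
def proj (c : UniversalCover X x₀) : X := c.1.src

/-- Left multiplication in `Π₁(X)` by `g ∈ π₁(X, x₀)`: run through the path first and through the
loop at `x₀` afterwards. -/
noncomputable instance : SMul (FundamentalGroup X x₀) (UniversalCover X x₀) where
  smul g c := ⟨Pi1.mul ⟨x₀, x₀, g⟩ c.1 c.2, rfl⟩

noncomputable instance : MulAction (FundamentalGroup X x₀) (UniversalCover X x₀) where
  one_smul c := Subtype.ext (Pi1.one_mul c.1 c.2)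
  mul_smul g k c := Subtype.ext <| by
    have h := Pi1.mul_assoc ⟨x₀, x₀, g⟩ ⟨x₀, x₀, k⟩ c.1 rfl c.2
    simp only [Pi1.mul_loop] at h
    exact h

end UniversalCover

/-- `Π₁(X)` has a Haar system. -/
def HasHaarSystem (X : Type u) [TopologicalSpace X] : Prop :=
  ∃ α : X → Measure (Pi1 X), IsHaarSystem α

/-- The universal covering space has a fully supported `π₁(X, x₀)`-invariant Radon measure. -/
def HasInvariantRadonMeasure (X : Type u) [TopologicalSpace X] (x₀ : X) : Prop :=
  ∃ μ : Measure (UniversalCover X x₀), μ.Regular ∧ μ.IsOpenPosMeasure ∧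
    SMulInvariantMeasure (FundamentalGroup X x₀) (UniversalCover X x₀) μ

/-- The space has a fully supported Radon measure. -/
def HasRadonMeasure (X : Type u) [TopologicalSpace X] [MeasurableSpace X] : Prop :=
  ∃ ν : Measure X, ν.Regular ∧ ν.IsOpenPosMeasure

/-!
The topological statements rest on one description of the quotient topology of `Π₁(X)`. Call an
open set of `X` simple if it is path connected and any two paths in it with the same end points
are homotopic in `X`; simple sets form a basis of `X` (`Pi1.exists_isSimple`). For an arrow `g`
and simple sets `U`, `V` about its source and range, the cylinder of all `b g a`, with `a` a path
in `U` and `b` a path in `V`, is open: a path close to a representative of `g` can be compared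
with it on the pieces of a fine subdivision of `[0, 1]` (`Pi1.isOpen_cylinder`). Such cylinders
are a neighbourhood basis of `g`, because constant paths may be added at the ends of a
representative of `g` and then moved a little (`Pi1.exists_cylinder_subset`). Hence the groupoid
operations are continuous and `(s, r) : Π₁(X) → X × X` is an open local homeomorphism, so that
`Π₁(X)` is locally compact and Hausdorff. The group `π₁(X, x₀)` acts on the closed subspace `X̃`
freely, transitively on the fibres of `p`, and with disjoint translates of small sets, which makes
`p` a covering map. The universal cover is simply connected since the lift of a path can be written
down: it is given by the classes of the tails of a path (`UniversalCover.mk_trans_eq`).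

A Haar system restricts to an invariant measure on the fibre `X̃` over `x₀`; its invariance is
checked on `C_c(Π₁(X))`, as the two measures involved are Radon. Conversely, `η ↦ ζ⁻¹ η` is a
homeomorphism of `X̃` onto the fibre over `p(ζ)` for every `ζ ∈ X̃`. By invariance, the image `α` of
`μ` depends only on `p(ζ)`. The integral of `f` against it is a continuous function of `ζ`, and
descends to a continuous function on `X`, because `p` is a quotient map.

A measure on `X` is lifted to `X̃` by the Riesz representation theorem, applied to the integral over
`X` of the sum of `f ∈ C_c(X̃)` over the fibres of `p`. That sum is continuous because
`π₁(X, x₀)` acts properly discontinuously: for compact sets `K` and `L` in `X̃`, the loops `d c⁻¹`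
with `c ∈ K`, `d ∈ L` form a compact set, and the isotropy group of `x₀` is discrete. In the other
direction, paracompactness of `X` provides a continuous function `h ≥ 0` on `X̃` that vanishes
identically on no fibre and whose support is proper over `X` (`exists_cutoff`); the functional
`f ↦ ∫ (f ∘ p) h dμ` on `C_c(X)` then represents a measure on `X`, which has full support since
every fibre meets `{h > 0}`.
-/

/-! ### Classes of paths in a given set, and cylinders -/

namespace Path.Homotopic.Quotient

variable {X : Type u} [TopologicalSpace X] {x y z : X}

theorem symm_trans_cancel_left (c : Path.Homotopic.Quotient x y)
    (d : Path.Homotopic.Quotient y z) : c.symm.trans (c.trans d) = d := by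
  rw [← trans_assoc, symm_trans, refl_trans]

theorem trans_symm_cancel_left (c : Path.Homotopic.Quotient x y)
    (d : Path.Homotopic.Quotient x z) : c.trans (c.symm.trans d) = d := by
  rw [← trans_assoc, trans_symm, refl_trans]

theorem symm_symm (c : Path.Homotopic.Quotient x y) : c.symm.symm = c := by
  obtain ⟨p, rfl⟩ := mk_surjective c
  rw [← mk_symm, ← mk_symm, Path.symm_symm]

theorem symm_of_trans (c : Path.Homotopic.Quotient x y) (d : Path.Homotopic.Quotient y z) :
    (c.trans d).symm = d.symm.trans c.symm := by
  obtain ⟨p, rfl⟩ := mk_surjective c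
  obtain ⟨q, rfl⟩ := mk_surjective d
  rw [← mk_trans, ← mk_symm, Path.trans_symm, mk_trans, mk_symm, mk_symm]

end Path.Homotopic.Quotient

namespace Pi1

section Groupoid

variable {X : Type u} [TopologicalSpace X]

/-- The class `c` has a representative whose range lies in `U`. -/
def IsWithin (U : Set X) {x y : X} (c : Path.Homotopic.Quotient x y) : Prop :=
  ∃ γ : Path x y, Set.range γ ⊆ U ∧ Path.Homotopic.Quotient.mk γ = c

variable {U V W : Set X} {x y z w : X}

theorem IsWithin.mono {c : Path.Homotopic.Quotient x y} (h : IsWithin U c) (hUV : U ⊆ V) :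
    IsWithin V c := by
  obtain ⟨γ, hγ, rfl⟩ := h
  exact ⟨γ, hγ.trans hUV, rfl⟩

theorem IsWithin.source_mem {c : Path.Homotopic.Quotient x y} (h : IsWithin U c) : x ∈ U := by
  obtain ⟨γ, hγ, rfl⟩ := h
  exact hγ ⟨0, γ.source⟩

theorem IsWithin.target_mem {c : Path.Homotopic.Quotient x y} (h : IsWithin U c) : y ∈ U := by
  obtain ⟨γ, hγ, rfl⟩ := h
  exact hγ ⟨1, γ.target⟩

theorem isWithin_refl (hx : x ∈ U) : IsWithin U (Path.Homotopic.Quotient.refl x) :=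
  ⟨Path.refl x, by simpa using hx, rfl⟩

theorem IsWithin.symm {c : Path.Homotopic.Quotient x y} (h : IsWithin U c) :
    IsWithin U c.symm := by
  obtain ⟨γ, hγ, rfl⟩ := h
  exact ⟨γ.symm, by simpa using hγ, rfl⟩

theorem IsWithin.trans {c : Path.Homotopic.Quotient x y} {d : Path.Homotopic.Quotient y z}
    (h : IsWithin U c) (h' : IsWithin U d) : IsWithin U (c.trans d) := by
  obtain ⟨γ, hγ, rfl⟩ := h
  obtain ⟨δ, hδ, rfl⟩ := h'
  exact ⟨γ.trans δ, by simp [Path.trans_range, hγ, hδ], rfl⟩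

theorem exists_isWithin (hU : IsPathConnected U) (hx : x ∈ U) (hy : y ∈ U) :
    ∃ c : Path.Homotopic.Quotient x y, IsWithin U c := by
  obtain ⟨γ, hγ⟩ := hU.joinedIn x hx y hy
  exact ⟨.mk γ, γ, by rintro _ ⟨t, rfl⟩; exact hγ t, rfl⟩

/-- A path connected open set that is relatively simply connected: any two paths in it with the
same end points are homotopic in the whole space. -/
structure IsSimple (U : Set X) : Prop where
  isOpen : IsOpen U
  isPathConnected : IsPathConnected U
  eq_of_isWithin : ∀ ⦃x y : X⦄ (c d : Path.Homotopic.Quotient x y),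
    IsWithin U c → IsWithin U d → c = d

theorem exists_isOpen_isPathConnected [LocallyPathConnectedSpace X] (hW : W ∈ 𝓝 x) :
    ∃ U, IsOpen U ∧ IsPathConnected U ∧ x ∈ U ∧ U ⊆ W := by
  have hx := mem_of_mem_nhds (interior_mem_nhds.2 hW)
  exact ⟨pathComponentIn (interior W) x, isOpen_interior.pathComponentIn x,
    isPathConnected_pathComponentIn hx, mem_pathComponentIn_self hx,
    pathComponentIn_subset.trans interior_subset⟩

/-- In a locally path connected, semilocally simply connected space, the simple sets form a
basis of the topology. -/
theorem exists_isSimple [LocallyPathConnectedSpace X] (hX : SemilocallySimplyConnected X)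
    (hW : W ∈ 𝓝 x) : ∃ U, IsSimple U ∧ x ∈ U ∧ U ⊆ W := by
  obtain ⟨N, hN, hloop⟩ := hX x
  obtain ⟨U, hUo, hUc, hxU, hU⟩ := exists_isOpen_isPathConnected (Filter.inter_mem hW hN)
  refine ⟨U, ⟨hUo, hUc, fun y z c d hc hd => ?_⟩, hxU, fun t ht => (hU ht).1⟩
  obtain ⟨r, hr⟩ := exists_isWithin hUc hxU hc.source_mem
  -- `r` joins `x` to the common source of `c` and `d`: running through `r`, `c`, `d` reversed and
  -- `r` reversed gives a loop at `x`
  obtain ⟨γ, hγ, hγc⟩ := ((hr.trans hc).trans hd.symm).trans hr.symm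
  have h1 : ((r.trans c).trans d.symm).trans r.symm = Path.Homotopic.Quotient.refl x := by
    rw [← hγc]
    exact Path.Homotopic.Quotient.eq.2 (hloop γ (hγ.trans fun t ht => (hU ht).2))
  have h2 : (r.symm.trans (((r.trans c).trans d.symm).trans r.symm)).trans (r.trans d) = c := by
    simp [Path.Homotopic.Quotient.trans_assoc, Path.Homotopic.Quotient.symm_trans_cancel_left]
  rw [← h2, h1]
  simp [Path.Homotopic.Quotient.symm_trans_cancel_left]

/-- The arrows `h = b g a`, where `a` is the class of a path in `U` that ends at the source
of `g` and `b` is the class of a path in `V` that starts at the range of `g`. -/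
def cylinder (U V : Set X) (g : Pi1 X) : Set (Pi1 X) :=
  {h | ∃ (a : Path.Homotopic.Quotient h.src g.src) (b : Path.Homotopic.Quotient g.tgt h.tgt),
    IsWithin U a ∧ IsWithin V b ∧ h.cls = (a.trans g.cls).trans b}

variable {g h k : Pi1 X}

theorem self_mem_cylinder (hU : g.src ∈ U) (hV : g.tgt ∈ V) : g ∈ cylinder U V g :=
  ⟨_, _, isWithin_refl hU, isWithin_refl hV, by simp⟩

theorem src_mem_of_mem_cylinder (hh : h ∈ cylinder U V g) : h.src ∈ U := by
  obtain ⟨a, b, ha, hb, -⟩ := hh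
  exact ha.source_mem

theorem tgt_mem_of_mem_cylinder (hh : h ∈ cylinder U V g) : h.tgt ∈ V := by
  obtain ⟨a, b, ha, hb, -⟩ := hh
  exact hb.target_mem

theorem cylinder_mono {U' V' : Set X} (hU : U ⊆ U') (hV : V ⊆ V') :
    cylinder U V g ⊆ cylinder U' V' g := fun _ ⟨a, b, ha, hb, e⟩ =>
  ⟨a, b, ha.mono hU, hb.mono hV, e⟩

theorem mem_cylinder_trans (hh : h ∈ cylinder U V g) (hk : k ∈ cylinder U V h) :
    k ∈ cylinder U V g := by
  obtain ⟨a, b, ha, hb, e⟩ := hh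
  obtain ⟨a', b', ha', hb', e'⟩ := hk
  refine ⟨a'.trans a, b.trans b', ha'.trans ha, hb.trans hb', ?_⟩
  rw [e', e]
  simp only [Path.Homotopic.Quotient.trans_assoc]

theorem mem_cylinder_symm (hh : h ∈ cylinder U V g) : g ∈ cylinder U V h := by
  obtain ⟨a, b, ha, hb, e⟩ := hh
  refine ⟨a.symm, b.symm, ha.symm, hb.symm, ?_⟩
  rw [e]
  simp [Path.Homotopic.Quotient.trans_assoc, Path.Homotopic.Quotient.symm_trans_cancel_left]

/-- On a cylinder over simple sets, an arrow is determined by its source and its range. -/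
theorem eq_of_mem_cylinder (hU : IsSimple U) (hV : IsSimple V) (hh : h ∈ cylinder U V g)
    (hk : k ∈ cylinder U V g) (hs : h.src = k.src) (ht : h.tgt = k.tgt) : h = k := by
  obtain ⟨x, y, c⟩ := h
  obtain ⟨x', y', d⟩ := k
  obtain ⟨a, b, ha, hb, e⟩ := hh
  obtain ⟨a', b', ha', hb', e'⟩ := hk
  dsimp only at hs ht a b a' b' e e'
  subst hs ht
  rw [e, e', hU.eq_of_isWithin a a' ha ha', hV.eq_of_isWithin b b' hb hb']

theorem exists_mem_cylinder (hU : IsPathConnected U) (hV : IsPathConnected V) (hs : g.src ∈ U)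
    (ht : g.tgt ∈ V) (hx : x ∈ U) (hy : y ∈ V) :
    ∃ h ∈ cylinder U V g, h.src = x ∧ h.tgt = y := by
  obtain ⟨a, ha⟩ := exists_isWithin hU hx hs
  obtain ⟨b, hb⟩ := exists_isWithin hV ht hy
  exact ⟨⟨x, y, (a.trans g.cls).trans b⟩, ⟨a, b, ha, hb, rfl⟩, rfl, rfl⟩

/-- The inverse of an arrow: the class of the reversed path. -/
def inv (γ : Pi1 X) : Pi1 X := ⟨γ.tgt, γ.src, γ.cls.symm⟩

/-- The short paths at the middle point cancel, since the middle set is simple. -/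
theorem mul_mem_cylinder {γ γ' η η' : Pi1 X} (e : η.tgt = γ.src) (e' : η'.tgt = γ'.src)
    (hV : IsSimple V) (hγ : γ' ∈ cylinder V W γ) (hη : η' ∈ cylinder U V η) :
    γ'.mul η' e' ∈ cylinder U W (γ.mul η e) := by
  obtain ⟨y, z, c⟩ := γ
  obtain ⟨y', z', c'⟩ := γ'
  obtain ⟨x, y, d⟩ := η
  obtain ⟨x', y', d'⟩ := η'
  dsimp only at e e'
  subst e e'
  obtain ⟨a, b, ha, hb, e⟩ := hγ
  obtain ⟨a', b', ha', hb', e'⟩ := hη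
  dsimp only at a b a' b' e e'
  subst e e'
  refine ⟨a', b, ha', hb, ?_⟩
  obtain rfl : b' = a.symm := hV.eq_of_isWithin _ _ hb' ha.symm
  simp [mul, Path.Homotopic.Quotient.trans_assoc, Path.Homotopic.Quotient.symm_trans_cancel_left]

end Groupoid

/-! ### The topology of the fundamental groupoid -/

section Topology

variable {X : Type u} [TopologicalSpace X]

open unitInterval

theorem continuous_ofPath : Continuous (ofPath (X := X)) := continuous_coinduced_rng

theorem isOpen_iff {O : Set (Pi1 X)} : IsOpen O ↔ IsOpen (ofPath ⁻¹' O) := isOpen_coinduced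

theorem ofPath_surjective : Function.Surjective (ofPath (X := X)) := by
  rintro ⟨x, y, c⟩
  obtain ⟨γ, rfl⟩ := Path.Homotopic.Quotient.mk_surjective c
  obtain ⟨f, rfl, rfl⟩ := γ
  exact ⟨f, rfl⟩

theorem isQuotientMap_ofPath : IsQuotientMap (ofPath (X := X)) :=
  ⟨⟨rfl⟩, ofPath_surjective⟩

theorem continuous_src : Continuous (src : Pi1 X → X) :=
  isQuotientMap_ofPath.continuous_iff.2 (continuous_eval_const (0 : I))

theorem continuous_tgt : Continuous (tgt : Pi1 X → X) :=
  isQuotientMap_ofPath.continuous_iff.2 (continuous_eval_const (1 : I))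

/-- The path underlying a continuous function on the unit interval. -/
def toPath (f : C(I, X)) : Path (f 0) (f 1) := ⟨f, rfl, rfl⟩

/-- The equality of arrows absorbs the dependence of the class on the end points. -/
theorem ofPath_coe {x y : X} (γ : Path x y) : ofPath (γ : C(I, X)) = ⟨x, y, .mk γ⟩ := by
  obtain ⟨f, rfl, rfl⟩ := γ
  rfl

theorem continuous_inv : Continuous (inv : Pi1 X → Pi1 X) := by
  refine isQuotientMap_ofPath.continuous_iff.2 ?_
  have h : Continuous fun f : C(I, X) => f.comp ⟨σ, continuous_symm⟩ :=
    ContinuousMap.continuous_precomp _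
  have e : inv ∘ ofPath (X := X) = ofPath ∘ fun f : C(I, X) => f.comp ⟨σ, continuous_symm⟩ :=
    funext fun f => (ofPath_coe (toPath f).symm).symm
  rw [e]
  exact continuous_ofPath.comp h

/-- The restriction of `f` to the interval from `s` to `t`, parametrized by `[0, 1]`. -/
def segment (f : C(I, X)) (s t : I) : Path (f s) (f t) := (toPath f).subpath s t

theorem segment_self (f : C(I, X)) (t : I) : segment f t t = Path.refl (f t) :=
  Path.subpath_self _ _

theorem segment_zero_one (f : C(I, X)) : segment f 0 1 = toPath f :=
  Path.subpath_zero_one _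

theorem isWithin_segment {f : C(I, X)} {s t : I} (h : s ≤ t) {U : Set X}
    (hf : Set.MapsTo f (Set.Icc s t) U) : IsWithin U (.mk (segment f s t)) :=
  ⟨_, (Path.range_subpath_of_le _ _ _ h).trans_subset hf.image_subset, rfl⟩

theorem mk_segment_trans (f : C(I, X)) (r s t : I) :
    (Path.Homotopic.Quotient.mk (segment f r s)).trans (.mk (segment f s t)) =
      .mk (segment f r t) :=
  Path.Homotopic.Quotient.eq.2 ⟨Path.Homotopy.subpathTransSubpath _ _ _ _⟩

/-- A path `f'` near `f` is homotopic to `f` up to short paths between the end points. The proof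
runs along a subdivision of `[0, 1]` whose pieces are mapped by `f` into simple sets. -/
theorem eventually_exists_segment_eq [LocallyPathConnectedSpace X]
    (f : C(I, X)) {U : Set X} (hU : U ∈ 𝓝 (f 0)) (t : ℕ → I)
    (ht0 : t 0 = 0) (htm : Monotone t)
    (htU : ∀ n, ∃ W, IsSimple W ∧ Set.MapsTo f (Set.Icc (t n) (t (n + 1))) W) (n : ℕ) :
    ∀ V ∈ 𝓝 (f (t n)), ∀ᶠ f' in 𝓝 f,
      ∃ (a : Path.Homotopic.Quotient (f' 0) (f 0))
        (b : Path.Homotopic.Quotient (f (t n)) (f' (t n))),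
      IsWithin U a ∧ IsWithin V b ∧ .mk (segment f' 0 (t n)) =
        (a.trans (.mk (segment f 0 (t n)))).trans b := by
  induction n with
  | zero =>
    rw [ht0]
    intro V hV
    obtain ⟨P, hPo, hPc, hfP, hP⟩ := exists_isOpen_isPathConnected (Filter.inter_mem hU hV)
    filter_upwards [(continuous_eval_const (F := C(I, X)) (0 : I)).continuousAt.preimage_mem_nhds
      (hPo.mem_nhds hfP)] with f' hf'
    obtain ⟨c, hc⟩ := exists_isWithin hPc hf' hfP
    refine ⟨c, c.symm, hc.mono fun _ h => (hP h).1, hc.symm.mono fun _ h => (hP h).2, ?_⟩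
    rw [segment_self, segment_self]
    simp
  | succ n ih =>
    intro V hV
    obtain ⟨W, hW, hfW⟩ := htU n
    have hle : t n ≤ t (n + 1) := htm n.le_succ
    have h1 : f (t n) ∈ W := hfW ⟨le_rfl, hle⟩
    have h2 : f (t (n + 1)) ∈ W := hfW ⟨hle, le_rfl⟩
    obtain ⟨P, hPo, hPc, hfP, hP⟩ :=
      exists_isOpen_isPathConnected (Filter.inter_mem hV (hW.isOpen.mem_nhds h2))
    filter_upwards [ih W (hW.isOpen.mem_nhds h1),
      (continuous_eval_const (F := C(I, X)) (t (n + 1))).continuousAt.preimage_mem_nhds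
        (hPo.mem_nhds hfP), ContinuousMap.eventually_mapsTo isCompact_Icc hW.isOpen hfW]
      with f' ⟨a, b, ha, hb, e⟩ hf'P hf'W
    obtain ⟨c, hc⟩ := exists_isWithin hPc hfP hf'P
    refine ⟨a, c, ha, hc.mono fun _ h => (hP h).1, ?_⟩
    -- both sides are classes of paths inside the simple set `W`
    have key : Path.Homotopic.Quotient.mk (segment f' (t n) (t (n + 1))) =
        (b.symm.trans (.mk (segment f (t n) (t (n + 1))))).trans c :=
      hW.eq_of_isWithin _ _ (isWithin_segment hle hf'W)
        ((hb.symm.trans (isWithin_segment hle hfW)).trans (hc.mono fun _ h => (hP h).2))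
    rw [← mk_segment_trans f' 0 (t n), ← mk_segment_trans f 0 (t n), e, key]
    simp [Path.Homotopic.Quotient.trans_assoc, Path.Homotopic.Quotient.trans_symm_cancel_left]

theorem eventually_ofPath_mem_cylinder [LocallyPathConnectedSpace X]
    (hX : SemilocallySimplyConnected X) (f : C(I, X)) {U V : Set X} (hU : U ∈ 𝓝 (f 0))
    (hV : V ∈ 𝓝 (f 1)) : ∀ᶠ f' in 𝓝 f, ofPath f' ∈ cylinder U V (ofPath f) := by
  obtain ⟨t, ht0, htm, ⟨n, hn⟩, ht⟩ := exists_monotone_Icc_subset_open_cover_unitInterval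
    (ι := {W : Set X // IsSimple W}) (c := fun W => f ⁻¹' W)
    (fun W => W.2.isOpen.preimage f.continuous) fun s _ => by
      obtain ⟨W, hW, hs, -⟩ := exists_isSimple hX (Filter.univ_mem (f := 𝓝 (f s)))
      exact Set.mem_iUnion.2 ⟨⟨W, hW⟩, hs⟩
  have h := eventually_exists_segment_eq f hU t ht0 htm
    (fun n => let ⟨W, hW⟩ := ht n; ⟨W, W.2, hW⟩) n
  rw [hn n le_rfl] at h
  filter_upwards [h V hV] with f' ⟨a, b, ha, hb, e⟩
  rw [segment_zero_one, segment_zero_one] at e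
  exact ⟨a, b, ha, hb, e⟩

theorem isOpen_cylinder [LocallyPathConnectedSpace X] (hX : SemilocallySimplyConnected X)
    {U V : Set X} (hU : IsOpen U) (hV : IsOpen V) (g : Pi1 X) : IsOpen (cylinder U V g) := by
  refine isOpen_iff.2 (isOpen_iff_mem_nhds.2 fun f hf => ?_)
  filter_upwards [eventually_ofPath_mem_cylinder hX f (hU.mem_nhds (src_mem_of_mem_cylinder hf))
    (hV.mem_nhds (tgt_mem_of_mem_cylinder hf))] with f' hf' using mem_cylinder_trans hf hf'

variable (X) in
/-- The space of triples of composable paths. -/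
abbrev ComposableTriple : Type u :=
  {p : C(I, X) × C(I, X) × C(I, X) // p.1 1 = p.2.1 0 ∧ p.2.1 1 = p.2.2 0}

/-- The concatenation of three composable paths. -/
noncomputable def concat (p : ComposableTriple X) :
    Path (p.1.1 0) (p.1.2.2 1) :=
  ((⟨p.1.1, rfl, p.2.1⟩ : Path (p.1.1 0) (p.1.2.1 0)).trans
    (⟨p.1.2.1, rfl, p.2.2⟩ : Path (p.1.2.1 0) (p.1.2.2 0))).trans ⟨p.1.2.2, rfl, rfl⟩

theorem continuous_concat : Continuous fun p : ComposableTriple X => (concat p : C(I, X)) := by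
  refine ContinuousMap.continuous_of_continuous_uncurry _ ?_
  refine Path.trans_continuous_family (fun p : ComposableTriple X => Path.trans
    (⟨p.1.1, rfl, p.2.1⟩ : Path (p.1.1 0) (p.1.2.1 0))
    (⟨p.1.2.1, rfl, p.2.2⟩ : Path (p.1.2.1 0) (p.1.2.2 0)))
    (Path.trans_continuous_family _ ?_ _ ?_) (fun p => ⟨p.1.2.2, rfl, rfl⟩) ?_
  · exact (continuous_subtype_val.comp continuous_fst).fst.eval continuous_snd
  · exact (continuous_subtype_val.comp continuous_fst).snd.fst.eval continuous_snd
  · exact (continuous_subtype_val.comp continuous_fst).snd.snd.eval continuous_snd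

/-- The paths with values in a small neighbourhood of `x` are near the constant path. -/
theorem exists_nhds_of_mem_nhds_const {x : X} {W : Set C(I, X)} (hW : W ∈ 𝓝 (.const I x)) :
    ∃ U ∈ 𝓝 x, ∀ f : C(I, X), Set.range f ⊆ U → f ∈ W := by
  obtain ⟨⟨K, U⟩, ⟨-, hU⟩, h⟩ := (𝓝 x).basis_sets.nhds_continuousMapConst.mem_iff.1 hW
  exact ⟨U, hU, fun f hf => h fun t _ => hf ⟨t, rfl⟩⟩

/-- Every neighbourhood of `g` contains a cylinder about `g`: the concatenation of a short path,
of a representative of `g` and of another short path is near the concatenation with the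
constant paths. -/
theorem exists_cylinder_subset {g : Pi1 X} {O : Set (Pi1 X)} (hO : O ∈ 𝓝 g) :
    ∃ U ∈ 𝓝 g.src, ∃ V ∈ 𝓝 g.tgt, cylinder U V g ⊆ O := by
  obtain ⟨f, rfl⟩ := ofPath_surjective g
  let p₀ : ComposableTriple X :=
    ⟨(.const I (f 0), f, .const I (f 1)), rfl, rfl⟩
  have e : ofPath (concat p₀ : C(I, X)) = ofPath f := by
    change _ = Pi1.mk (f 0) (f 1) (.mk ⟨f, rfl, rfl⟩)
    rw [ofPath_coe]
    trans Pi1.mk (f 0) (f 1) (((Path.Homotopic.Quotient.refl (f 0)).trans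
      (.mk ⟨f, rfl, rfl⟩)).trans (Path.Homotopic.Quotient.refl (f 1)))
    · rfl
    · exact congrArg (Pi1.mk _ _) ((Path.Homotopic.Quotient.trans_refl _).trans
        (Path.Homotopic.Quotient.refl_trans _))
  have h : (fun p => ofPath (concat p : C(I, X))) ⁻¹' O ∈ 𝓝 p₀ :=
    (continuous_ofPath.comp continuous_concat).continuousAt.preimage_mem_nhds
      (by rw [Function.comp_apply, e]; exact hO)
  obtain ⟨N, hN, hNO⟩ := (mem_nhds_subtype _ _ _).1 h
  obtain ⟨W, hW, W', hW', hWN⟩ := mem_nhds_prod_iff.1 hN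
  obtain ⟨W₁, hW₁, W₂, hW₂, hWW⟩ := mem_nhds_prod_iff.1 hW'
  obtain ⟨U, hU, hUW⟩ := exists_nhds_of_mem_nhds_const hW
  obtain ⟨V, hV, hVW⟩ := exists_nhds_of_mem_nhds_const hW₂
  refine ⟨U, hU, V, hV, ?_⟩
  rintro ⟨x, y, c⟩ ⟨a, b, ⟨α, hα, rfl⟩, ⟨β, hβ, rfl⟩, hc⟩
  dsimp only at α β hc
  subst hc
  let p : ComposableTriple X :=
    ⟨((α : C(I, X)), f, (β : C(I, X))), α.target, β.source.symm⟩
  have hp : ofPath (concat p : C(I, X)) ∈ O :=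
    hNO (a := p) (hWN ⟨hUW _ hα, hWW ⟨mem_of_mem_nhds hW₁, hVW _ hβ⟩⟩)
  have e' : (concat p : C(I, X)) =
      ((α.trans (⟨f, rfl, rfl⟩ : Path (f 0) (f 1))).trans β : Path x y) := rfl
  rw [e', ofPath_coe] at hp
  exact hp

theorem exists_isSimple_cylinder_subset [LocallyPathConnectedSpace X]
    (hX : SemilocallySimplyConnected X) {g : Pi1 X} {O : Set (Pi1 X)} (hO : O ∈ 𝓝 g) :
    ∃ U V, IsSimple U ∧ IsSimple V ∧ g.src ∈ U ∧ g.tgt ∈ V ∧ cylinder U V g ⊆ O := by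
  obtain ⟨U, hU, V, hV, h⟩ := exists_cylinder_subset hO
  obtain ⟨U', hU', hgU, hUU⟩ := exists_isSimple hX hU
  obtain ⟨V', hV', hgV, hVV⟩ := exists_isSimple hX hV
  exact ⟨U', V', hU', hV', hgU, hgV, (cylinder_mono hUU hVV).trans h⟩

end Topology
end Pi1

namespace Pi1

variable {X : Type u} [TopologicalSpace X]

theorem mk_mul_mk {x y z : X} (c : Path.Homotopic.Quotient y z)
    (d : Path.Homotopic.Quotient x y) : mul ⟨y, z, c⟩ ⟨x, y, d⟩ rfl = ⟨x, z, d.trans c⟩ := by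
  simp only [mul, Path.Homotopic.Quotient.cast_rfl_rfl]

/-- The source and the range of an arrow. -/
def ends (g : Pi1 X) : X × X := (g.src, g.tgt)

theorem continuous_ends : Continuous (ends : Pi1 X → X × X) :=
  continuous_src.prodMk continuous_tgt

variable [LocallyPathConnectedSpace X]

theorem continuous_mul (hX : SemilocallySimplyConnected X) :
    Continuous fun q : {q : Pi1 X × Pi1 X // q.2.tgt = q.1.src} => q.1.1.mul q.1.2 q.2 := by
  refine continuous_iff_continuousAt.2 ?_
  rintro ⟨⟨γ, η⟩, e⟩ O hO
  obtain ⟨U, W, hU, hW, hgU, hgW, h⟩ := exists_isSimple_cylinder_subset hX hO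
  obtain ⟨V, hV, hgV, -⟩ := exists_isSimple hX (Filter.univ_mem (f := 𝓝 γ.src))
  have h1 : cylinder V W γ ∈ 𝓝 γ :=
    (isOpen_cylinder hX hV.isOpen hW.isOpen γ).mem_nhds (self_mem_cylinder hgV hgW)
  have h2 : cylinder U V η ∈ 𝓝 η := (isOpen_cylinder hX hU.isOpen hV.isOpen η).mem_nhds
    (self_mem_cylinder hgU (by dsimp only at e; rwa [e]))
  rw [Filter.mem_map]
  exact Filter.mem_of_superset (continuous_subtype_val.continuousAt.preimage_mem_nhds
    (prod_mem_nhds h1 h2)) fun q hq =>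
      h (mul_mem_cylinder e q.2 hV hq.1 hq.2)

theorem isOpenMap_ends (hX : SemilocallySimplyConnected X) :
    IsOpenMap (ends : Pi1 X → X × X) := by
  refine isOpenMap_iff_nhds_le.2 fun g O hO => ?_
  obtain ⟨U, V, hU, hV, hgU, hgV, h⟩ := exists_isSimple_cylinder_subset hX hO
  refine Filter.mem_of_superset
    (prod_mem_nhds (hU.isOpen.mem_nhds hgU) (hV.isOpen.mem_nhds hgV)) ?_
  rintro ⟨x, y⟩ ⟨hx, hy⟩
  obtain ⟨k, hk, rfl, rfl⟩ := exists_mem_cylinder hU.isPathConnected hV.isPathConnected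
    hgU hgV hx hy
  exact h hk

/-- The map that sends an arrow to its source and range is locally injective. -/
theorem exists_isOpen_injOn_ends (hX : SemilocallySimplyConnected X) (g : Pi1 X) :
    ∃ N, IsOpen N ∧ g ∈ N ∧ Set.InjOn ends N := by
  obtain ⟨U, V, hU, hV, hgU, hgV, -⟩ :=
    exists_isSimple_cylinder_subset hX (Filter.univ_mem (f := 𝓝 g))
  exact ⟨_, isOpen_cylinder hX hU.isOpen hV.isOpen g, self_mem_cylinder hgU hgV,
    fun h hh k hk e => eq_of_mem_cylinder hU hV hh hk (congrArg Prod.fst e) (congrArg Prod.snd e)⟩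

theorem t2Space [T2Space X] (hX : SemilocallySimplyConnected X) : T2Space (Pi1 X) := by
  refine ⟨fun g h hne => ?_⟩
  by_cases he : ends g = ends h
  · obtain ⟨x, y, c⟩ := g
    obtain ⟨x', y', d⟩ := h
    obtain ⟨rfl, rfl⟩ := Prod.mk.inj he
    obtain ⟨U, hU, hxU, -⟩ := exists_isSimple hX (Filter.univ_mem (f := 𝓝 x))
    obtain ⟨V, hV, hyV, -⟩ := exists_isSimple hX (Filter.univ_mem (f := 𝓝 y))
    refine ⟨_, _, isOpen_cylinder hX hU.isOpen hV.isOpen _,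
      isOpen_cylinder hX hU.isOpen hV.isOpen _, self_mem_cylinder hxU hyV,
      self_mem_cylinder hxU hyV, Set.disjoint_left.2 fun k hk hk' => hne ?_⟩
    exact eq_of_mem_cylinder hU hV (mem_cylinder_symm hk) (mem_cylinder_symm hk') rfl rfl
  · exact separated_by_continuous continuous_ends he

theorem locallyCompactSpace [T2Space X] [LocallyCompactSpace X]
    (hX : SemilocallySimplyConnected X) : LocallyCompactSpace (Pi1 X) := by
  have := t2Space hX
  have : WeaklyLocallyCompactSpace (Pi1 X) := by
    refine ⟨fun g => ?_⟩
    obtain ⟨N, hN, hg, hinj⟩ := exists_isOpen_injOn_ends hX g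
    have hemb : IsOpenEmbedding (N.domRestrict ends) :=
      .of_continuous_injective_isOpenMap (continuous_ends.comp continuous_subtype_val)
        hinj.injective ((isOpenMap_ends hX).domRestrict hN)
    have := hemb.locallyCompactSpace
    obtain ⟨K, hK, hKg⟩ := exists_compact_mem_nhds (⟨g, hg⟩ : N)
    exact ⟨Subtype.val '' K, hK.image continuous_subtype_val,
      hN.isOpenMap_subtype_val.image_mem_nhds hKg⟩
  infer_instance

/-- A compact set contains only finitely many arrows with a given source and range. -/
theorem finite_inter_ends_of_isCompact [T2Space X] (hX : SemilocallySimplyConnected X)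
    {K : Set (Pi1 X)} (hK : IsCompact K) (p : X × X) : (K ∩ ends ⁻¹' {p}).Finite := by
  choose N hN hg hinj using exists_isOpen_injOn_ends hX
  obtain ⟨t, -, ht⟩ := (hK.inter_right
    ((isClosed_singleton (x := p)).preimage continuous_ends)).elim_nhds_subcover N
      fun g _ => (hN g).mem_nhds (hg g)
  refine (t.finite_toSet.biUnion (t := fun g => N g ∩ ends ⁻¹' {p}) fun g _ => ?_).subset ?_
  · exact Set.Subsingleton.finite fun h hh k hk => hinj g hh.1 hk.1 (hh.2.trans hk.2.symm)
  · intro h hh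
    obtain ⟨g, hgt, hgN⟩ := Set.mem_iUnion₂.1 (ht hh)
    exact Set.mem_iUnion₂.2 ⟨g, hgt, hgN, hh.2⟩

end Pi1

namespace UniversalCover

/-! ### The universal cover as a covering space -/

section Covering

variable {X : Type u} [TopologicalSpace X] {x₀ : X}

/-- The inclusion of the universal cover into the fundamental groupoid. -/
def arrow (c : UniversalCover X x₀) : Pi1 X := c.1

theorem arrow_tgt (c : UniversalCover X x₀) : (arrow c).tgt = x₀ := c.2

theorem arrow_injective : Function.Injective (arrow : UniversalCover X x₀ → Pi1 X) :=
  Subtype.val_injective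

/-- The point of the universal cover given by a homotopy class of paths to the base point. -/
def ofClass {x : X} (c : Path.Homotopic.Quotient x x₀) : UniversalCover X x₀ :=
  ⟨⟨x, x₀, c⟩, rfl⟩

theorem exists_ofClass (c : UniversalCover X x₀) :
    ∃ (x : X) (d : Path.Homotopic.Quotient x x₀), c = ofClass d := by
  obtain ⟨⟨x, y, d⟩, rfl⟩ := c
  exact ⟨x, d, rfl⟩

theorem ofClass_injective {x : X} :
    Function.Injective (ofClass : Path.Homotopic.Quotient x x₀ → UniversalCover X x₀) :=
  fun _ _ h => eq_of_heq (Pi1.mk.inj (congrArg arrow h)).2.2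

theorem isEmbedding_arrow : IsEmbedding (arrow : UniversalCover X x₀ → Pi1 X) :=
  IsEmbedding.subtypeVal

theorem continuous_arrow : Continuous (arrow : UniversalCover X x₀ → Pi1 X) :=
  isEmbedding_arrow.continuous

theorem continuous_proj : Continuous (proj : UniversalCover X x₀ → X) :=
  Pi1.continuous_src.comp continuous_arrow

theorem range_arrow : Set.range (arrow : UniversalCover X x₀ → Pi1 X) = Pi1.rangeFibre x₀ :=
  Subtype.range_val

theorem isClosedEmbedding_arrow [T1Space X] :
    IsClosedEmbedding (arrow : UniversalCover X x₀ → Pi1 X) :=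
  (isClosed_singleton.preimage Pi1.continuous_tgt).isClosedEmbedding_subtypeVal

theorem proj_smul (g : FundamentalGroup X x₀) (c : UniversalCover X x₀) :
    proj (g • c) = proj c := rfl

theorem smul_ofClass {x : X} (g : FundamentalGroup X x₀) (c : Path.Homotopic.Quotient x x₀) :
    g • ofClass c = ofClass (c.trans g) :=
  arrow_injective (Pi1.mk_mul_mk (z := x₀) g c)

theorem exists_smul_eq {c d : UniversalCover X x₀} (h : proj c = proj d) :
    ∃ g : FundamentalGroup X x₀, g • d = c := by
  obtain ⟨x, c, rfl⟩ := exists_ofClass c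
  obtain ⟨x', d, rfl⟩ := exists_ofClass d
  obtain rfl : x = x' := h
  refine ⟨d.symm.trans c, ?_⟩
  rw [smul_ofClass]
  exact congrArg ofClass (Path.Homotopic.Quotient.trans_symm_cancel_left d c)

theorem eq_one_of_smul_eq {g : FundamentalGroup X x₀} {c : UniversalCover X x₀}
    (h : g • c = c) : g = 1 := by
  obtain ⟨x, c, rfl⟩ := exists_ofClass c
  rw [smul_ofClass] at h
  have h' := congrArg c.symm.trans (ofClass_injective h)
  rw [Path.Homotopic.Quotient.symm_trans] at h'
  exact (Path.Homotopic.Quotient.symm_trans_cancel_left c g).symm.trans h'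

theorem proj_surjective [PathConnectedSpace X] :
    Function.Surjective (proj : UniversalCover X x₀ → X) := fun x =>
  ⟨⟨⟨x, x₀, .mk (PathConnectedSpace.somePath x x₀)⟩, rfl⟩, rfl⟩

variable [LocallyPathConnectedSpace X]

theorem t2Space [T2Space X] (hX : SemilocallySimplyConnected X) :
    T2Space (UniversalCover X x₀) :=
  have := Pi1.t2Space hX
  inferInstanceAs (T2Space {γ : Pi1 X // γ.tgt = x₀})

theorem locallyCompactSpace [T2Space X] [LocallyCompactSpace X]
    (hX : SemilocallySimplyConnected X) : LocallyCompactSpace (UniversalCover X x₀) :=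
  have := Pi1.locallyCompactSpace hX
  isClosedEmbedding_arrow.locallyCompactSpace

theorem continuousConstSMul (hX : SemilocallySimplyConnected X) :
    ContinuousConstSMul (FundamentalGroup X x₀) (UniversalCover X x₀) := by
  refine ⟨fun g => Continuous.subtype_mk ?_ _⟩
  exact (Pi1.continuous_mul hX).comp (f := fun c : UniversalCover X x₀ =>
    (⟨(⟨x₀, x₀, g⟩, arrow c), arrow_tgt c⟩ : {q : Pi1 X × Pi1 X // q.2.tgt = q.1.src}))
    ((continuous_const.prodMk continuous_arrow).subtype_mk _)

theorem isOpenMap_proj (hX : SemilocallySimplyConnected X) :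
    IsOpenMap (proj : UniversalCover X x₀ → X) := by
  refine isOpenMap_iff_nhds_le.2 fun c O hO => ?_
  obtain ⟨O', hO', hOO⟩ := isEmbedding_arrow.isInducing.nhds_eq_comap c ▸ hO
  obtain ⟨U, V, hU, hV, hgU, hgV, h⟩ := Pi1.exists_isSimple_cylinder_subset hX hO'
  filter_upwards [hU.isOpen.mem_nhds hgU] with x hx
  obtain ⟨k, hk, rfl, ht⟩ := Pi1.exists_mem_cylinder hU.isPathConnected hV.isPathConnected
    hgU hgV hx hgV
  exact hOO (a := ⟨k, ht.trans c.2⟩) (h hk)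

/-- The projection is the quotient by the fundamental group: translates of a set on which source
and range determine the arrow are disjoint. -/
theorem isQuotientCoveringMap_proj [PathConnectedSpace X] (hX : SemilocallySimplyConnected X) :
    IsQuotientCoveringMap (proj : UniversalCover X x₀ → X) (FundamentalGroup X x₀) := by
  have := continuousConstSMul (x₀ := x₀) hX
  refine
    { toIsQuotientMap := (isOpenMap_proj hX).isQuotientMap continuous_proj proj_surjective
      continuous_const_smul := continuous_const_smul
      apply_eq_iff_mem_orbit := fun {c d} => ⟨exists_smul_eq, ?_⟩
      disjoint := fun c => ?_ }
  · rintro ⟨g, rfl⟩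
    exact proj_smul g d
  · obtain ⟨N, hN, hc, hinj⟩ := Pi1.exists_isOpen_injOn_ends hX (arrow c)
    refine ⟨arrow ⁻¹' N, (hN.preimage continuous_arrow).mem_nhds hc, ?_⟩
    rintro g ⟨_, ⟨d, hd, rfl⟩, hgd⟩
    exact eq_one_of_smul_eq (arrow_injective (hinj hgd hd
      (Prod.ext rfl ((arrow_tgt (g • d)).trans (arrow_tgt d).symm))))

theorem isCoveringMap_proj [PathConnectedSpace X] (hX : SemilocallySimplyConnected X) :
    IsCoveringMap (proj : UniversalCover X x₀ → X) :=
  (isQuotientCoveringMap_proj hX).isCoveringMap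

end Covering

/-! ### Lifting of paths -/

section SimplyConnected

open unitInterval

variable {X : Type u} [TopologicalSpace X] {x y z : X}

/-- The point of the universal cover based at `y` given by the part of a path to `y` that
follows the time `t`. -/
def tail (p : Path x y) (t : I) : UniversalCover X y :=
  ofClass (.mk ((p.subpath t 1).cast rfl p.target.symm))

theorem arrow_tail (p : Path x y) (t : I) : arrow (tail p t) = Pi1.ofPath (p.subpath t 1) :=
  (Pi1.ofPath_coe ((p.subpath t 1).cast rfl p.target.symm)).symm

theorem continuous_tail (p : Path x y) : Continuous (tail p) := by
  refine isEmbedding_arrow.continuous_iff.2 ?_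
  refine Continuous.congr (f := fun t => Pi1.ofPath (p.subpath t 1)) ?_
    fun t => (arrow_tail p t).symm
  refine Pi1.continuous_ofPath.comp (ContinuousMap.continuous_of_continuous_uncurry _ ?_)
  exact p.subpath_continuous_family.comp (f := fun q : I × I => (q.1, 1, q.2)) (by fun_prop)

/-- If `p` runs along `q` after the time `t`, its tail at `t` is the class of `q`. -/
theorem tail_eq {p : Path x y} {t : I} {q : Path z y} (h : ∀ s, p.subpath t 1 s = q s) :
    tail p t = ofClass (.mk q) :=
  arrow_injective <| (arrow_tail p t).trans <|
    (congrArg Pi1.ofPath (ContinuousMap.ext h)).trans (Pi1.ofPath_coe q)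

theorem tail_zero (p : Path x y) : tail p 0 = ofClass (.mk p) :=
  tail_eq fun s => by simp

theorem tail_one (p : Path x y) : tail p 1 = ofClass (.refl y) :=
  tail_eq (q := .refl y) fun s => by simp

/-- The second half of a concatenation is its second path. -/
theorem tail_trans_half (p : Path x y) (q : Path y z) {t : I} (ht : (t : ℝ) = 1 / 2) :
    tail (p.trans q) t = ofClass (.mk q) := by
  refine tail_eq fun s => ?_
  change (p.trans q) (Set.Icc.convexComb t 1 s) = q s
  have e : ((Set.Icc.convexComb t 1 s : I) : ℝ) = 1 / 2 + s / 2 := by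
    rw [Set.Icc.coe_convexComb, ht]
    simp only [Set.Icc.coe_one]
    ring
  rw [Path.trans_apply]
  split_ifs with h
  · obtain rfl : s = 0 := by
      ext
      have := s.2.1
      simp only [Set.Icc.coe_zero]
      linarith
    rw [q.source]
    convert p.target
    simp [ht]
  · congr 1
    ext
    simp only [e]
    ring

/-- The tails of a path join its class to the class of the constant path. -/
instance : PathConnectedSpace (UniversalCover X y) := by
  have key : ∀ c : UniversalCover X y, Joined (ofClass (.refl y)) c := by
    intro c
    obtain ⟨x, d, rfl⟩ := exists_ofClass c
    obtain ⟨p, rfl⟩ := Path.Homotopic.Quotient.mk_surjective d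
    exact Joined.symm ⟨⟨⟨tail p, continuous_tail p⟩, tail_zero p, tail_one p⟩⟩
  exact ⟨⟨ofClass (.refl y)⟩, fun c d => (key c).symm.trans (key d)⟩

/-- The end point of a path `Γ` in the universal cover is determined by its starting point and
its projection `p`: the path of tails of the reverse of `p` followed by a representative of
the starting point is a lift of `p`, hence equal to `Γ`. -/
theorem mk_trans_eq [PathConnectedSpace X] [LocallyPathConnectedSpace X]
    (hX : SemilocallySimplyConnected X) {d : Path.Homotopic.Quotient x z}
    {d' : Path.Homotopic.Quotient y z} (Γ : Path (ofClass d) (ofClass d')) (p : Path x y)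
    (hp : ∀ t, proj (Γ t) = p t) : (Path.Homotopic.Quotient.mk p).trans d' = d := by
  obtain ⟨q, rfl⟩ := Path.Homotopic.Quotient.mk_surjective d
  -- at the time `(1 - t) / 2` the path `p.symm.trans q` is at `p t`
  let r : I → I := fun t => ⟨(1 - t) / 2, by
    constructor <;> have := t.2.1 <;> have := t.2.2 <;> linarith⟩
  have hr : Continuous r := by fun_prop
  have h : (fun t => tail (p.symm.trans q) (r t)) = ⇑Γ := by
    refine (isCoveringMap_proj hX).eq_of_comp_eq ((continuous_tail _).comp hr) Γ.continuous
      (funext fun t => ?_) 0 ?_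
    · change (p.symm.trans q) (r t) = proj (Γ t)
      have h2 : (r t : ℝ) ≤ 1 / 2 := by
        have := t.2.1
        simp only [r]
        linarith
      rw [Path.trans_apply, dif_pos h2, Path.symm_apply, hp]
      refine congrArg p (Subtype.ext ?_)
      simp only [r, coe_symm_eq]
      ring
    · rw [Γ.source, tail_trans_half p.symm q (by simp [r])]
  have h1 := congrFun h 1
  rw [Γ.target, show r 1 = 0 by ext; simp [r], tail_zero] at h1
  rw [← ofClass_injective h1]
  simp [Path.Homotopic.Quotient.trans_symm_cancel_left]

theorem simplyConnectedSpace [PathConnectedSpace X] [LocallyPathConnectedSpace X]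
    (hX : SemilocallySimplyConnected X) : SimplyConnectedSpace (UniversalCover X z) := by
  refine simply_connected_iff_paths_homotopic'.2 ⟨inferInstance, fun {c c'} Γ Γ' => ?_⟩
  obtain ⟨x, d, rfl⟩ := exists_ofClass c
  obtain ⟨y, d', rfl⟩ := exists_ofClass c'
  refine Path.Homotopic.Quotient.eq.1
    ((isCoveringMap_proj hX).injective_path_homotopic_map (ofClass d) (ofClass d') ?_)
  let p : Path x y := Γ.map continuous_proj
  let p' : Path x y := Γ'.map continuous_proj
  have h := congrArg (fun e => e.trans d'.symm)
    ((mk_trans_eq hX Γ p fun _ => rfl).trans (mk_trans_eq hX Γ' p' fun _ => rfl).symm)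
  simp only [Path.Homotopic.Quotient.trans_assoc, Path.Homotopic.Quotient.trans_symm,
    Path.Homotopic.Quotient.trans_refl] at h
  exact h

end SimplyConnected

end UniversalCover

/-! ### Radon measures -/

section Regular

variable {A B : Type*} [TopologicalSpace A] [MeasurableSpace A] [BorelSpace A]
  [TopologicalSpace B] [MeasurableSpace B] [BorelSpace B] {f : A → B}

/-- The image of a Radon measure under a closed embedding is a Radon measure. -/
theorem Topology.IsClosedEmbedding.regular_map (hf : IsClosedEmbedding f) (μ : Measure A)
    [μ.Regular] : (μ.map f).Regular where
  lt_top_of_isCompact K hK := by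
    rw [hf.measurableEmbedding.map_apply]
    exact (hf.isCompact_preimage hK).measure_lt_top
  outerRegular S _ r hr := by
    rw [hf.measurableEmbedding.map_apply] at hr
    obtain ⟨U, hSU, hU, hUr⟩ := Set.exists_isOpen_lt_of_lt _ r hr
    obtain ⟨V, hV, rfl⟩ := hf.isInducing.isOpen_iff.1 hU
    -- the complement of the closed range is open and null
    refine ⟨V ∪ (Set.range f)ᶜ, fun y hy => ?_, hV.union hf.isClosed_range.isOpen_compl, ?_⟩
    · by_cases h : y ∈ Set.range f
      · obtain ⟨x, rfl⟩ := h
        exact .inl (hSU hy)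
      · exact .inr h
    · rw [hf.measurableEmbedding.map_apply]
      simpa using hUr
  innerRegular U hU r hr := by
    rw [hf.measurableEmbedding.map_apply] at hr
    obtain ⟨K, hKU, hK, hrK⟩ := (hU.preimage hf.continuous).exists_lt_isCompact hr
    refine ⟨f '' K, Set.image_subset_iff.2 hKU, hK.image hf.continuous, ?_⟩
    rwa [hf.measurableEmbedding.map_apply, hf.injective.preimage_image]

/-- The restriction of a Radon measure to a closed set that carries it is a Radon measure. -/
theorem Topology.IsClosedEmbedding.regular_comap (hf : IsClosedEmbedding f) (μ : Measure B)
    [μ.Regular] (h : μ (Set.range f)ᶜ = 0) : (μ.comap f).Regular := by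
  have h1 := Measure.OuterRegular.comap' μ hf.continuous hf.measurableEmbedding
  have h2 := IsFiniteMeasureOnCompacts.comap' μ hf.continuous hf.measurableEmbedding
  refine ⟨fun U hU r hr => ?_⟩
  obtain ⟨V, hV, rfl⟩ := hf.isInducing.isOpen_iff.1 hU
  have key : ∀ S, μ.comap f (f ⁻¹' S) = μ S := fun S => by
    rw [hf.measurableEmbedding.comap_apply, Set.image_preimage_eq_inter_range]
    exact measure_inter_conull h
  rw [key] at hr
  obtain ⟨K, hKV, hK, hrK⟩ := hV.exists_lt_isCompact hr
  exact ⟨f ⁻¹' K, Set.preimage_mono hKV, hf.isCompact_preimage hK, by rwa [key]⟩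

end Regular

section Riesz

open CompactlySupported

variable {Y : Type*} [TopologicalSpace Y] [T2Space Y] [LocallyCompactSpace Y]

theorem exists_continuous_hasCompactSupport_pos {U : Set Y} (hU : IsOpen U) {y : Y} (hy : y ∈ U) :
    ∃ f : Y → ℝ, Continuous f ∧ HasCompactSupport f ∧ 0 ≤ f ∧ 0 < f y ∧ ∀ z ∉ U, f z = 0 := by
  obtain ⟨f, h1, h0, hc, hf⟩ := exists_continuous_one_zero_of_isCompact
    (isCompact_singleton (x := y)) hU.isClosed_compl
    (Set.disjoint_singleton_left.2 fun h => h hy)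
  exact ⟨f, f.continuous, hc, fun z => (hf z).1, by simp [h1 rfl], fun z hz => h0 hz⟩

variable [MeasurableSpace Y] [BorelSpace Y]

/-- A strictly positive linear functional on `C_c` is the integral of a fully supported
Radon measure. -/
theorem exists_regular_isOpenPosMeasure (Λ : C_c(Y, ℝ) →ₗ[ℝ] ℝ)
    (hpos : ∀ f : C_c(Y, ℝ), 0 ≤ f → (∃ y, 0 < f y) → 0 < Λ f) :
    ∃ μ : Measure Y, μ.Regular ∧ μ.IsOpenPosMeasure ∧ ∀ f : C_c(Y, ℝ), ∫ y, f y ∂μ = Λ f := by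
  have hnonneg : ∀ f : C_c(Y, ℝ), 0 ≤ f → 0 ≤ Λ f := fun f hf => by
    by_cases h : ∃ y, 0 < f y
    · exact (hpos f hf h).le
    · push Not at h
      have : f = 0 := CompactlySupportedContinuousMap.ext fun y => le_antisymm (h y) (hf y)
      rw [this, map_zero]
  have hint : ∀ f : C_c(Y, ℝ),
      ∫ y, f y ∂(RealRMK.rieszMeasure (PositiveLinearMap.mk₀ Λ hnonneg)) = Λ f := fun f =>
    (RealRMK.integral_rieszMeasure (PositiveLinearMap.mk₀ Λ hnonneg) f).symm ▸ rfl
  refine ⟨_, RealRMK.regular_rieszMeasure _, ⟨?_⟩, hint⟩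
  rintro U hU ⟨y, hy⟩ h
  obtain ⟨f, hfc, hfs, hf0, hfy, hfU⟩ := exists_continuous_hasCompactSupport_pos hU hy
  let F : C_c(Y, ℝ) := ⟨⟨f, hfc⟩, hfs⟩
  refine (hpos F hf0 ⟨y, hfy⟩).ne' ?_
  rw [← hint F]
  refine integral_eq_zero_of_ae (measure_mono_null (fun z hz => ?_) h)
  by_contra hzU
  exact hz (hfU z hzU)

end Riesz

/-! ### Descent of measures along open maps -/

section Descent

variable {E X : Type*} [TopologicalSpace E] [TopologicalSpace X] {p : E → X}

/-- Along a continuous open surjection `p` onto a paracompact space, there is a non-negative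
continuous function that vanishes identically on no fibre and whose support meets the
preimage of each compact set in a compact set. -/
theorem exists_cutoff [T2Space E] [LocallyCompactSpace E] [T2Space X] [LocallyCompactSpace X]
    [ParacompactSpace X] (hp : Continuous p) (hpo : IsOpenMap p) (hps : Function.Surjective p) :
    ∃ h : E → ℝ, Continuous h ∧ 0 ≤ h ∧ (∀ x, ∃ c, p c = x ∧ 0 < h c) ∧
      ∀ f : X → ℝ, HasCompactSupport f → HasCompactSupport fun c => f (p c) * h c := by
  -- functions `k x`, positive at a point above `x`, are patched by a partition of unity on the base
  choose s hs using hps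
  choose k hkc hks hk0 hkpos _ using fun x =>
    exists_continuous_hasCompactSupport_pos isOpen_univ (Set.mem_univ (s x))
  obtain ⟨ρ, hρ⟩ := PartitionOfUnity.exists_isSubordinate (X := X) isClosed_univ
    (fun x => p '' {c | 0 < k x c}) (fun x => hpo _ (isOpen_lt continuous_const (hkc x)))
    (fun x _ => Set.mem_iUnion.2 ⟨x, s x, hkpos x, hs x⟩)
  have hlf : LocallyFinite fun x => Function.support fun c => ρ x (p c) * k x c :=
    (ρ.locallyFinite.preimage_continuous hp).subset fun x c hc => left_ne_zero_of_mul hc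
  have hnn : ∀ c x, 0 ≤ ρ x (p c) * k x c := fun c x => mul_nonneg (ρ.nonneg _ _) (hk0 _ _)
  refine ⟨fun c => ∑ᶠ x, ρ x (p c) * k x c,
    continuous_finsum (fun x => ((ρ x).continuous.comp hp).mul (hkc x)) hlf,
    fun c => finsum_nonneg (hnn c), fun y => ?_, fun f hf => ?_⟩
  · obtain ⟨x, hx⟩ := ρ.exists_pos (Set.mem_univ y)
    obtain ⟨c, hc, rfl⟩ := hρ x (subset_tsupport _ hx.ne')
    refine ⟨c, rfl, (mul_pos hx hc).trans_le ?_⟩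
    exact single_le_finsum x (hlf.point_finite c) (hnn c)
  · have hfin := ρ.locallyFinite.finite_nonempty_inter_compact hf
    refine HasCompactSupport.intro (hfin.isCompact_biUnion fun x _ => hks x) fun c hc => ?_
    by_contra hne
    have hfc : p c ∈ tsupport f := subset_tsupport _ (left_ne_zero_of_mul hne)
    obtain ⟨x, hx⟩ : ∃ x, ρ x (p c) * k x c ≠ 0 := by
      by_contra! h
      exact right_ne_zero_of_mul hne (finsum_eq_zero_of_forall_eq_zero h)
    exact hc (Set.mem_iUnion₂.2 ⟨x, ⟨p c, left_ne_zero_of_mul hx, hfc⟩,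
      subset_tsupport _ (right_ne_zero_of_mul hx)⟩)

open CompactlySupported in
/-- A fully supported Radon measure descends along a continuous open surjection onto a paracompact
space: integrate against a cutoff function. -/
theorem exists_regular_of_isOpenMap [T2Space E] [LocallyCompactSpace E] [MeasurableSpace E]
    [BorelSpace E] [T2Space X] [LocallyCompactSpace X] [MeasurableSpace X] [BorelSpace X]
    [ParacompactSpace X] (hp : Continuous p) (hpo : IsOpenMap p) (hps : Function.Surjective p)
    (μ : Measure E) [μ.Regular] [μ.IsOpenPosMeasure] :
    ∃ ν : Measure X, ν.Regular ∧ ν.IsOpenPosMeasure := by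
  obtain ⟨h, hc, h0, hpos, hcs⟩ := exists_cutoff hp hpo hps
  have hcont : ∀ f : C_c(X, ℝ), Continuous fun c => f (p c) * h c := fun f =>
    (f.continuous.comp hp).mul hc
  have hint : ∀ f : C_c(X, ℝ), Integrable (fun c => f (p c) * h c) μ := fun f =>
    (hcont f).integrable_of_hasCompactSupport (hcs f f.hasCompactSupport)
  let Λ : C_c(X, ℝ) →ₗ[ℝ] ℝ :=
    { toFun := fun f => ∫ c, f (p c) * h c ∂μ
      map_add' := fun f g => by
        rw [← integral_add (hint f) (hint g)]
        simp [add_mul]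
      map_smul' := fun r f => by
        rw [RingHom.id_apply, smul_eq_mul, ← integral_const_mul]
        simp [mul_assoc] }
  obtain ⟨ν, h1, h2, -⟩ := exists_regular_isOpenPosMeasure Λ fun f hf ⟨x, hx⟩ => by
    obtain ⟨c, rfl, hch⟩ := hpos x
    exact (hcont f).integral_pos_of_hasCompactSupport_nonneg_nonzero (hcs f f.hasCompactSupport)
      (fun c => mul_nonneg (hf (p c)) (h0 c)) (mul_pos hx hch).ne'
  exact ⟨ν, h1, h2⟩

end Descent

/-! ### Lifting of measures along quotient covering maps -/

section Lift

variable {E X G : Type*} [TopologicalSpace E] [TopologicalSpace X] {p : E → X} [Group G]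
  [MulAction G E]

/-- The function on the orbit space whose value at `x` is the sum of `f` over the fibre
of `x`, parametrized by the group through a chosen point of the fibre. For a free action that is
transitive on the fibres, the choice is immaterial. -/
noncomputable def fibreSum (G : Type*) [Group G] [MulAction G E] (hp : Function.Surjective p)
    (f : E → ℝ) (x : X) : ℝ :=
  ∑ᶠ g : G, f (g • Function.surjInv hp x)

theorem fibreSum_apply (hp : IsQuotientCoveringMap p G) (f : E → ℝ) (c : E) :
    fibreSum G hp.surjective f (p c) = ∑ᶠ g : G, f (g • c) := by
  obtain ⟨k, hk⟩ := hp.apply_eq_iff_mem_orbit.1 (Function.surjInv_eq hp.surjective (p c))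
  dsimp only at hk
  rw [fibreSum, ← hk]
  simp only [smul_smul]
  exact finsum_comp_equiv (Equiv.mulRight k) (f := fun g => f (g • c))

theorem fibreSum_smul (hp : IsQuotientCoveringMap p G) (f : E → ℝ) (g : G) :
    fibreSum G hp.surjective (fun c => f (g • c)) = fibreSum G hp.surjective f := by
  funext x
  obtain ⟨c, rfl⟩ := hp.surjective x
  rw [fibreSum_apply hp, fibreSum_apply hp]
  simp only [smul_smul]
  exact finsum_comp_equiv (Equiv.mulLeft g) (f := fun g => f (g • c))

theorem hasCompactSupport_fibreSum [T2Space X] (hp : IsQuotientCoveringMap p G) {f : E → ℝ}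
    (hfs : HasCompactSupport f) : HasCompactSupport (fibreSum G hp.surjective f) := by
  refine HasCompactSupport.intro (hfs.isCompact.image hp.continuous) fun x hx => ?_
  obtain ⟨c, rfl⟩ := hp.surjective x
  rw [fibreSum_apply hp]
  refine finsum_eq_zero_of_forall_eq_zero fun g => ?_
  by_contra h
  exact hx ⟨g • c, subset_tsupport _ h, hp.map_smul g⟩

variable [LocallyCompactSpace E] [ProperlyDiscontinuousSMul G E]

/-- A compact neighbourhood of a point has only finitely many translates that meet the support. -/
theorem locallyFinite_support_smul {f : E → ℝ} (hf : HasCompactSupport f) :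
    LocallyFinite fun g : G => Function.support fun c => f (g • c) := fun c => by
  obtain ⟨K, hK, hcK⟩ := exists_compact_mem_nhds c
  refine ⟨K, hcK, (ProperlyDiscontinuousSMul.finite_disjoint_inter_image (Γ := G) hK hf).subset ?_⟩
  rintro g ⟨d, hd, hdK⟩
  exact ⟨g • d, ⟨d, hdK, rfl⟩, subset_tsupport _ hd⟩

theorem continuous_fibreSum (hp : IsQuotientCoveringMap p G) {f : E → ℝ} (hf : Continuous f)
    (hfs : HasCompactSupport f) : Continuous (fibreSum G hp.surjective f) := by
  have := hp.toContinuousConstSMul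
  refine hp.toIsQuotientMap.continuous_iff.2 (Continuous.congr ?_
    fun c => (fibreSum_apply hp f c).symm)
  exact continuous_finsum (fun g => hf.comp (continuous_const_smul g))
    (locallyFinite_support_smul hfs)

open CompactlySupported in
/-- A fully supported Radon measure on the base of a quotient covering map lifts to an invariant
one on the total space: a function is integrated by summing it over the fibres. -/
theorem exists_regular_smulInvariantMeasure [T2Space E] [MeasurableSpace E] [BorelSpace E]
    [T2Space X] [MeasurableSpace X] [BorelSpace X] (hp : IsQuotientCoveringMap p G)
    (ν : Measure X) [ν.Regular] [ν.IsOpenPosMeasure] :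
    ∃ μ : Measure E, μ.Regular ∧ μ.IsOpenPosMeasure ∧ SMulInvariantMeasure G E μ := by
  have := hp.toContinuousConstSMul
  have hc : ∀ f : C_c(E, ℝ), Continuous (fibreSum G hp.surjective f) := fun f =>
    continuous_fibreSum hp f.continuous f.hasCompactSupport
  have hs : ∀ f : C_c(E, ℝ), HasCompactSupport (fibreSum G hp.surjective f) := fun f =>
    hasCompactSupport_fibreSum hp f.hasCompactSupport
  have hint : ∀ f : C_c(E, ℝ), Integrable (fibreSum G hp.surjective f) ν := fun f =>
    (hc f).integrable_of_hasCompactSupport (hs f)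
  have hfin : ∀ (f : C_c(E, ℝ)) (c : E), (Function.support fun g : G => f (g • c)).Finite :=
    fun f c => (locallyFinite_support_smul f.hasCompactSupport).point_finite c
  let Λ : C_c(E, ℝ) →ₗ[ℝ] ℝ :=
    { toFun := fun f => ∫ x, fibreSum G hp.surjective f x ∂ν
      map_add' := fun f g => by
        rw [← integral_add (hint f) (hint g)]
        refine integral_congr_ae (.of_forall fun x => ?_)
        exact finsum_add_distrib (hfin f _) (hfin g _)
      map_smul' := fun r f => by
        rw [RingHom.id_apply, smul_eq_mul, ← integral_const_mul]
        refine integral_congr_ae (.of_forall fun x => ?_)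
        exact (mul_finsum _ _).symm }
  obtain ⟨μ, h1, h2, h3⟩ := exists_regular_isOpenPosMeasure Λ fun f hf ⟨c, hfc⟩ => by
    have hnn : 0 ≤ fibreSum G hp.surjective f := fun x => finsum_nonneg fun g => hf _
    refine (hc f).integral_pos_of_hasCompactSupport_nonneg_nonzero (hs f) hnn (x := p c)
      (ne_of_gt ?_)
    rw [fibreSum_apply hp]
    refine lt_of_lt_of_le ?_ (single_le_finsum (1 : G) (hfin f c) fun g => hf _)
    simpa using hfc
  refine ⟨μ, h1, h2, ⟨fun g S hS => ?_⟩⟩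
  have hg : μ.map (g • ·) = μ := by
    have := Measure.Regular.map (μ := μ) (Homeomorph.smul g)
    change (μ.map (Homeomorph.smul g)) = μ
    refine Measure.ext_of_integral_eq_on_compactlySupported fun f => ?_
    rw [(Homeomorph.smul g).measurableEmbedding.integral_map, h3]
    let F : C_c(E, ℝ) := ⟨⟨fun c => f (g • c), f.continuous.comp (continuous_const_smul g)⟩,
      f.hasCompactSupport.comp_homeomorph (Homeomorph.smul g)⟩
    -- translating `f` permutes the summands of its fibre sums
    have hF : Λ F = Λ f := congrArg (fun φ => ∫ x, φ x ∂ν) (fibreSum_smul hp f g)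
    exact (h3 F).trans hF
  rw [← Measure.map_apply (measurable_const_smul g) hS, hg]

end Lift

namespace UniversalCover

/-! ### Quotients of points of the universal cover -/

section Quotients

variable {X : Type u} [TopologicalSpace X] {x₀ : X}

/-- The arrow `ζ⁻¹ η` for two points `ζ`, `η` of the universal cover. -/
noncomputable def div (ζ η : UniversalCover X x₀) : Pi1 X :=
  Pi1.mul (Pi1.inv (arrow ζ)) (arrow η) ((arrow_tgt η).trans (arrow_tgt ζ).symm)

/-- The product `ζ θ` of a point of the universal cover and an arrow. -/
noncomputable def mulArrow (ζ : UniversalCover X x₀) (θ : Pi1 X) (h : θ.tgt = proj ζ) :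
    UniversalCover X x₀ :=
  ⟨Pi1.mul (arrow ζ) θ h, arrow_tgt ζ⟩

theorem div_ofClass {x y : X} (c : Path.Homotopic.Quotient x x₀)
    (d : Path.Homotopic.Quotient y x₀) :
    div (ofClass c) (ofClass d) = ⟨y, x, d.trans c.symm⟩ :=
  Pi1.mk_mul_mk c.symm d

theorem mulArrow_ofClass {x y : X} (c : Path.Homotopic.Quotient x x₀)
    (d : Path.Homotopic.Quotient y x) :
    mulArrow (ofClass c) ⟨y, x, d⟩ rfl = ofClass (d.trans c) :=
  arrow_injective (Pi1.mk_mul_mk c d)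

theorem tgt_div (ζ η : UniversalCover X x₀) : (div ζ η).tgt = proj ζ := rfl

theorem div_mulArrow (ζ : UniversalCover X x₀) (θ : Pi1 X) (h : θ.tgt = proj ζ) :
    div ζ (mulArrow ζ θ h) = θ := by
  obtain ⟨x, c, rfl⟩ := exists_ofClass ζ
  obtain ⟨y, x', d⟩ := θ
  obtain rfl : x' = x := h
  rw [mulArrow_ofClass, div_ofClass]
  simp [Path.Homotopic.Quotient.trans_assoc]

theorem mulArrow_div (ζ η : UniversalCover X x₀) : mulArrow ζ (div ζ η) rfl = η := by
  obtain ⟨x, c, rfl⟩ := exists_ofClass ζ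
  obtain ⟨y, d, rfl⟩ := exists_ofClass η
  have key : ∀ θ h, θ = ⟨y, x, d.trans c.symm⟩ → mulArrow (ofClass c) θ h = ofClass d := by
    rintro _ h rfl
    rw [mulArrow_ofClass]
    simp [Path.Homotopic.Quotient.trans_assoc]
  exact key _ _ (div_ofClass c d)

theorem div_smul_smul (g : FundamentalGroup X x₀) (ζ η : UniversalCover X x₀) :
    div (g • ζ) (g • η) = div ζ η := by
  obtain ⟨x, c, rfl⟩ := exists_ofClass ζ
  obtain ⟨y, d, rfl⟩ := exists_ofClass η
  rw [smul_ofClass, smul_ofClass, div_ofClass, div_ofClass]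
  refine congrArg (Pi1.mk y x) ?_
  generalize (show Path.Homotopic.Quotient x₀ x₀ from g) = g'
  rw [Path.Homotopic.Quotient.symm_of_trans, Path.Homotopic.Quotient.trans_assoc,
    Path.Homotopic.Quotient.trans_symm_cancel_left]

theorem mul_div (γ : Pi1 X) (ζ η : UniversalCover X x₀) (h : proj ζ = γ.src) :
    γ.mul (div ζ η) h = div (mulArrow ζ (Pi1.inv γ) h.symm) η := by
  obtain ⟨x, c, rfl⟩ := exists_ofClass ζ
  obtain ⟨y, d, rfl⟩ := exists_ofClass η
  obtain ⟨x', z, e⟩ := γ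
  obtain rfl : x = x' := h
  have e₁ : mulArrow (ofClass c) (Pi1.inv ⟨x, z, e⟩) rfl = ofClass (e.symm.trans c) :=
    mulArrow_ofClass c e.symm
  have e₂ : ∀ θ h, θ = ⟨y, x, d.trans c.symm⟩ →
      Pi1.mul ⟨x, z, e⟩ θ h = ⟨y, z, (d.trans c.symm).trans e⟩ := by
    rintro _ h rfl
    exact Pi1.mk_mul_mk _ _
  rw [e₁]
  refine (e₂ _ _ (div_ofClass c d)).trans ?_
  rw [div_ofClass, Path.Homotopic.Quotient.symm_of_trans,
    Path.Homotopic.Quotient.symm_symm, Path.Homotopic.Quotient.trans_assoc]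

theorem range_div (ζ : UniversalCover X x₀) : Set.range (div ζ) = Pi1.rangeFibre (proj ζ) :=
  Set.Subset.antisymm (Set.range_subset_iff.2 (tgt_div ζ))
    fun θ hθ => ⟨mulArrow ζ θ hθ, div_mulArrow ζ θ hθ⟩

variable [LocallyPathConnectedSpace X]

theorem continuous_div (hX : SemilocallySimplyConnected X) :
    Continuous fun q : UniversalCover X x₀ × UniversalCover X x₀ => div q.1 q.2 :=
  (Pi1.continuous_mul hX).comp (f := fun q : UniversalCover X x₀ × UniversalCover X x₀ =>
    (⟨(Pi1.inv (arrow q.1), arrow q.2), (arrow_tgt q.2).trans (arrow_tgt q.1).symm⟩ :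
      {q : Pi1 X × Pi1 X // q.2.tgt = q.1.src}))
    (((Pi1.continuous_inv.comp (continuous_arrow.comp continuous_fst)).prodMk
      (continuous_arrow.comp continuous_snd)).subtype_mk _)

theorem continuous_mulArrow (hX : SemilocallySimplyConnected X) :
    Continuous fun q : {q : UniversalCover X x₀ × Pi1 X // q.2.tgt = proj q.1} =>
      mulArrow q.1.1 q.1.2 q.2 :=
  isEmbedding_arrow.continuous_iff.2 <| (Pi1.continuous_mul hX).comp
    (f := fun q : {q : UniversalCover X x₀ × Pi1 X // q.2.tgt = proj q.1} =>
      (⟨(arrow q.1.1, q.1.2), q.2⟩ : {q : Pi1 X × Pi1 X // q.2.tgt = q.1.src}))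
    (((continuous_arrow.comp continuous_subtype_val.fst).prodMk
      continuous_subtype_val.snd).subtype_mk _)

/-- Division by `ζ` maps the universal cover homeomorphically onto the fibre of the range map over
`proj ζ`; multiplication by `ζ` is its inverse. -/
theorem isClosedEmbedding_div [T2Space X] (hX : SemilocallySimplyConnected X)
    (ζ : UniversalCover X x₀) : IsClosedEmbedding (div ζ) := by
  let e : UniversalCover X x₀ ≃ₜ Pi1.rangeFibre (proj ζ) :=
    { toFun := fun η => ⟨div ζ η, tgt_div ζ η⟩
      invFun := fun θ => mulArrow ζ θ.1 θ.2
      left_inv := mulArrow_div ζ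
      right_inv := fun θ => Subtype.ext (div_mulArrow ζ θ.1 θ.2)
      continuous_toFun :=
        ((continuous_div hX).comp (.prodMk continuous_const continuous_id)).subtype_mk _
      continuous_invFun := (continuous_mulArrow hX).comp
        (f := fun θ : Pi1.rangeFibre (proj ζ) =>
          (⟨(ζ, θ.1), θ.2⟩ : {q : UniversalCover X x₀ × Pi1 X // q.2.tgt = proj q.1}))
        ((continuous_const.prodMk continuous_subtype_val).subtype_mk _) }
  have hcl : IsClosed (Pi1.rangeFibre (proj ζ)) := isClosed_singleton.preimage Pi1.continuous_tgt
  exact hcl.isClosedEmbedding_subtypeVal.comp e.isClosedEmbedding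

/-- If `ζ` and `ζ⁻¹ η` stay in compact sets, so does `η`. -/
theorem exists_isCompact_of_div_mem [T2Space X] (hX : SemilocallySimplyConnected X)
    {K : Set (UniversalCover X x₀)} (hK : IsCompact K) {S : Set (Pi1 X)} (hS : IsCompact S) :
    ∃ L : Set (UniversalCover X x₀), IsCompact L ∧ ∀ ζ ∈ K, ∀ η, div ζ η ∈ S → η ∈ L := by
  have hcl : IsClosed {q : UniversalCover X x₀ × Pi1 X | q.2.tgt = proj q.1} :=
    isClosed_eq (Pi1.continuous_tgt.comp continuous_snd) (continuous_proj.comp continuous_fst)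
  refine ⟨_, ((hcl.isClosedEmbedding_subtypeVal.isCompact_preimage (hK.prod hS)).image
    (continuous_mulArrow hX)), fun ζ hζ η hη => ?_⟩
  exact ⟨⟨(ζ, div ζ η), tgt_div ζ η⟩, ⟨hζ, hη⟩, mulArrow_div ζ η⟩

/-- The fundamental group acts properly discontinuously: the loops `d c⁻¹`, for `c` and `d` in
compact sets, form a compact subset of the discrete isotropy group of the base point. -/
theorem properlyDiscontinuousSMul [T2Space X] (hX : SemilocallySimplyConnected X) :
    ProperlyDiscontinuousSMul (FundamentalGroup X x₀) (UniversalCover X x₀) := by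
  refine ⟨fun {K L} hK hL => ?_⟩
  let D := {q : UniversalCover X x₀ × UniversalCover X x₀ // proj q.1 = proj q.2}
  have hcl : IsClosed {q : UniversalCover X x₀ × UniversalCover X x₀ | proj q.1 = proj q.2} :=
    isClosed_eq (continuous_proj.comp continuous_fst) (continuous_proj.comp continuous_snd)
  let m : D → Pi1 X := fun q => Pi1.mul (arrow q.1.2) (Pi1.inv (arrow q.1.1)) q.2
  have hm : Continuous m := (Pi1.continuous_mul hX).comp (f := fun q : D =>
    (⟨(arrow q.1.2, Pi1.inv (arrow q.1.1)), q.2⟩ : {q : Pi1 X × Pi1 X // q.2.tgt = q.1.src}))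
    (((continuous_arrow.comp continuous_subtype_val.snd).prodMk
      (Pi1.continuous_inv.comp (continuous_arrow.comp continuous_subtype_val.fst))).subtype_mk _)
  have hcomp : IsCompact (m '' (Subtype.val ⁻¹' (K ×ˢ L))) :=
    (hcl.isClosedEmbedding_subtypeVal.isCompact_preimage (hK.prod hL)).image hm
  have hinj : Function.Injective fun g : FundamentalGroup X x₀ => (⟨x₀, x₀, g⟩ : Pi1 X) :=
    fun g g' h => eq_of_heq (Pi1.mk.inj h).2.2
  refine ((Pi1.finite_inter_ends_of_isCompact hX hcomp (x₀, x₀)).preimage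
    hinj.injOn).subset ?_
  rintro g ⟨_, ⟨c, hc, rfl⟩, hgc⟩
  refine ⟨⟨⟨(c, g • c), rfl⟩, ⟨hc, hgc⟩, ?_⟩, rfl⟩
  obtain ⟨x, c, rfl⟩ := exists_ofClass c
  have key : ∀ c' h, c' = ofClass (c.trans g) →
      Pi1.mul (arrow c') (Pi1.inv (arrow (ofClass c))) h = ⟨x₀, x₀, g⟩ := by
    rintro _ h rfl
    refine (Pi1.mk_mul_mk (z := x₀) _ c.symm).trans (congrArg (Pi1.mk x₀ x₀) ?_)
    exact Path.Homotopic.Quotient.symm_trans_cancel_left c g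
  exact key _ _ (smul_ofClass g c)

end Quotients

/-! ### Haar systems and invariant measures -/

section Haar

variable {X : Type u} [TopologicalSpace X] [T2Space X] [LocallyCompactSpace X]
  [LocallyPathConnectedSpace X] {x₀ : X}

/-- The restriction of a Haar system to the fibre over `x₀` is invariant, as invariance under a loop
can be tested on `C_c(Π₁(X))`. -/
theorem hasInvariantRadonMeasure_of_hasHaarSystem (hX : SemilocallySimplyConnected X)
    (h : HasHaarSystem X) : HasInvariantRadonMeasure X x₀ := by
  obtain ⟨α, hα⟩ := h
  have := Pi1.t2Space hX
  have := Pi1.locallyCompactSpace hX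
  have := continuousConstSMul (x₀ := x₀) hX
  have := hα.regular x₀
  have hemb := isClosedEmbedding_arrow (X := X) (x₀ := x₀)
  have hnull : α x₀ (Set.range (arrow : UniversalCover X x₀ → Pi1 X))ᶜ = 0 := by
    rw [range_arrow]
    exact hα.concentrated x₀
  let μ : Measure (UniversalCover X x₀) := (α x₀).comap arrow
  have hμ : μ.Regular := hemb.regular_comap _ hnull
  have hmap : μ.map arrow = α x₀ := by
    rw [hemb.measurableEmbedding.map_comap]
    exact Measure.restrict_eq_self_of_ae_mem (by rwa [ae_iff])
  refine ⟨μ, hμ, ⟨fun U hU hne => ?_⟩, ⟨fun g S hS => ?_⟩⟩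
  · obtain ⟨O, hO, rfl⟩ := isEmbedding_arrow.isInducing.isOpen_iff.1 hU
    obtain ⟨c, hc⟩ := hne
    rw [← hemb.measurableEmbedding.map_apply, hmap]
    have hsupp : arrow c ∈ (α x₀).support := by
      rw [hα.support_eq]
      exact arrow_tgt c
    exact ((Measure.mem_support_iff_forall _).1 hsupp O (hO.mem_nhds hc)).ne'
  · have := Measure.Regular.map (μ := μ) (Homeomorph.smul g)
    have hg : μ.map (Homeomorph.smul g) = μ := by
      refine MeasurableEmbedding.map_injective hemb.measurableEmbedding ?_
      have h1 := hemb.regular_map (μ.map (Homeomorph.smul g))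
      rw [hmap]
      refine Measure.ext_of_integral_eq_on_compactlySupported fun f => ?_
      rw [hemb.measurableEmbedding.integral_map,
        (Homeomorph.smul g).measurableEmbedding.integral_map]
      have h2 := hα.invariant ⟨x₀, x₀, g⟩ (fun η => (f η : ℂ))
        (Complex.continuous_ofReal.comp f.continuous)
        (f.hasCompactSupport.comp_left Complex.ofReal_zero)
      dsimp only at h2
      rw [← hmap, hemb.measurableEmbedding.integral_map, hmap, integral_complex_ofReal] at h2
      have h3 : ∀ c : UniversalCover X x₀,
          Pi1.translate ⟨x₀, x₀, g⟩ (fun η => (f η : ℂ)) (arrow c) =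
            (f (arrow (g • c)) : ℂ) := fun c => dif_pos (arrow_tgt c)
      simp only [h3] at h2
      rw [integral_complex_ofReal] at h2
      exact Complex.ofReal_injective h2
    rw [← Measure.map_apply (measurable_const_smul g) hS]
    exact congrArg (· S) hg

/-- The measure on the fibre over `proj ζ` is the image of `μ` under division by `ζ`. -/
theorem hasHaarSystem_of_hasInvariantRadonMeasure [PathConnectedSpace X]
    (hX : SemilocallySimplyConnected X)
    (h : HasInvariantRadonMeasure X x₀) : HasHaarSystem X := by
  obtain ⟨μ, hμ, hopen, hinv⟩ := h
  have := Pi1.t2Space hX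
  have := t2Space (x₀ := x₀) hX
  have := locallyCompactSpace (x₀ := x₀) hX
  have := continuousConstSMul (x₀ := x₀) hX
  have hcov := isQuotientCoveringMap_proj (x₀ := x₀) hX
  have hemb := isClosedEmbedding_div (x₀ := x₀) hX
  let α : X → Measure (Pi1 X) := fun u => μ.map (div (Function.surjInv hcov.surjective u))
  -- by invariance, the measure on the fibre does not depend on the chosen point above `u`
  have hα : ∀ ζ : UniversalCover X x₀, α (proj ζ) = μ.map (div ζ) := fun ζ => by
    obtain ⟨g, hg⟩ := exists_smul_eq (Function.surjInv_eq hcov.surjective (proj ζ))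
    have e : div ζ = div (g • ζ) ∘ (g • ·) := funext fun η => (div_smul_smul g ζ η).symm
    rw [e, ← Measure.map_map (hemb _).continuous.measurable (measurable_const_smul g),
      (measurePreserving_smul g μ).map_eq, hg]
  have hint : ∀ (ζ : UniversalCover X x₀) (f : Pi1 X → ℂ),
      ∫ θ, f θ ∂(α (proj ζ)) = ∫ η, f (div ζ η) ∂μ := fun ζ f => by
    rw [hα, (hemb ζ).measurableEmbedding.integral_map]
  have hnull : ∀ u, α u (Pi1.rangeFibre u)ᶜ = 0 := fun u => by
    obtain ⟨ζ, rfl⟩ := hcov.surjective u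
    rw [hα, (hemb ζ).measurableEmbedding.map_apply, ← range_div ζ]
    simp
  refine ⟨α, ⟨fun u => ?_, hnull, fun u => ?_, fun f hf hfs => ⟨?_, ?_⟩, fun γ f hf hfs => ?_⟩⟩
  · exact (hemb _).regular_map μ
  · obtain ⟨ζ, rfl⟩ := hcov.surjective u
    refine Set.Subset.antisymm ?_ fun θ hθ => ?_
    · exact Measure.support_subset_of_isClosed (isClosed_singleton.preimage Pi1.continuous_tgt)
        (hnull _)
    · refine (Measure.mem_support_iff_forall _).2 fun O hO => ?_
      rw [hα, (hemb ζ).measurableEmbedding.map_apply]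
      refine Measure.measure_pos_of_mem_nhds μ (x := mulArrow ζ θ hθ)
        ((hemb ζ).continuous.continuousAt.preimage_mem_nhds ?_)
      exact (div_mulArrow ζ θ hθ).symm ▸ hO
  · refine hcov.toIsQuotientMap.continuous_iff.2 ?_
    refine Continuous.congr (f := fun ζ => ∫ η, f (div ζ η) ∂μ) ?_ fun ζ => (hint ζ f).symm
    refine continuous_iff_continuousAt.2 fun ζ => ?_
    obtain ⟨K, hK, hζK⟩ := exists_compact_mem_nhds ζ
    obtain ⟨L, hL, hKL⟩ := exists_isCompact_of_div_mem hX hK hfs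
    refine (continuousOn_integral_of_compact_support (f := fun ζ η => f (div ζ η)) hL
      (hf.comp (continuous_div hX)).continuousOn fun ζ' η hζ' hη => ?_).continuousAt hζK
    by_contra hne
    exact hη (hKL ζ' hζ' η (subset_tsupport _ hne))
  · refine HasCompactSupport.intro (hfs.isCompact.image Pi1.continuous_tgt) fun u hu => ?_
    obtain ⟨ζ, rfl⟩ := hcov.surjective u
    rw [hint]
    refine integral_eq_zero_of_ae (.of_forall fun η => ?_)
    by_contra hne
    exact hu ⟨div ζ η, subset_tsupport _ hne, rfl⟩
  · obtain ⟨ζ, hζ⟩ := hcov.surjective γ.src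
    -- `γ ζ⁻¹ η = (ζ γ⁻¹)⁻¹ η`, and `ζ γ⁻¹` lies above the range of `γ`
    have h1 := hint (mulArrow ζ (Pi1.inv γ) hζ.symm) f
    change ∫ θ, f θ ∂(α γ.tgt) = _ at h1
    rw [← hζ, hint]
    refine Eq.trans (integral_congr_ae (.of_forall fun η => ?_)) h1.symm
    exact (dif_pos hζ).trans (congrArg f (mul_div γ ζ η hζ))

end Haar

end UniversalCover

theorem mainTheorem2 (X : Type u) [TopologicalSpace X] [T2Space X] [LocallyCompactSpace X]
    [PathConnectedSpace X] [LocallyPathConnectedSpace X] (hX : SemilocallySimplyConnected X)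
    [MeasurableSpace X] [BorelSpace X] (x₀ : X) :
    (IsCoveringMap (UniversalCover.proj : UniversalCover X x₀ → X) ∧
      SimplyConnectedSpace (UniversalCover X x₀)) ∧
    (HasHaarSystem X ↔ HasInvariantRadonMeasure X x₀) ∧
    (HasRadonMeasure X → HasInvariantRadonMeasure X x₀) ∧
    (ParacompactSpace X → HasInvariantRadonMeasure X x₀ → HasRadonMeasure X) := by
  have := UniversalCover.t2Space (x₀ := x₀) hX
  have := UniversalCover.locallyCompactSpace (x₀ := x₀) hX
  have := UniversalCover.properlyDiscontinuousSMul (x₀ := x₀) hX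
  refine ⟨⟨UniversalCover.isCoveringMap_proj hX, UniversalCover.simplyConnectedSpace hX⟩,
    ⟨UniversalCover.hasInvariantRadonMeasure_of_hasHaarSystem hX,
      UniversalCover.hasHaarSystem_of_hasInvariantRadonMeasure hX⟩, ?_, ?_⟩
  · rintro ⟨ν, hν, hν'⟩
    exact exists_regular_smulInvariantMeasure (UniversalCover.isQuotientCoveringMap_proj hX) ν
  · rintro hpara ⟨μ, hμ, hμ', -⟩
    exact exists_regular_of_isOpenMap UniversalCover.continuous_proj
      (UniversalCover.isOpenMap_proj hX) UniversalCover.proj_surjective μ
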